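/- Consider a discounted, infinite-horizon, cost-minimising Markov decision process with finite non-empty state space $\mathcal X$, finite non-empty action space $\mathcal A$, costs $g(x,a)$, transition probabilities $P_a(x,x')$ and discount factor $\alpha\in(0,1)$. For a stationary policy $\mu:\mathcal X\to\mathcal A$ let $P_\mu(x,x')=P_{\mu(x)}(x,x')$, $g_\mu(x)=g(x,\mu(x))$ and $J_\mu=\sum_{t\ge0}\alpha^tP_\mu^tg_\mu$; let $J^*(x)=\min_\mu J_\mu(x)$, let $\mu^*$ be an optimal policy ($J_{\mu^*}=J^*$), and let $(TJ)(x)=\min_{a}\big(g(x,a)+\alpha\sum_{x'}P_a(x,x')J(x')\big)$. Let $\nu$ be a probability distribution on $\mathcal X$ and $\pi_{\mu^*,\nu}^\top=(1-\alpha)\sum_{t\ge0}\alpha^t\nu^\top P_{\mu^*}^t$. Let $\Phi\in\mathbb R^{\mathcal X\times K}$ be a matrix whose columns (the basis functions) contain the constant function $\mathbf 1$ in their span. Write $\|J\|_{1,\nu}=\sum_x\nu(x)|J(x)|$, $\Psi=\{\psi\in\mathbb R^{\mathcal X}:\psi\ge\mathbf 1\}$, $\|J\|_{\infty,\mathbf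 1/\psi}=\max_x|J(x)|/\psi(x)$, $\beta(\psi)=\max_{x,a}\big|\sum_{x'}P_a(x,x')\psi(x')/\psi(x)\big|$, and $u^+$ for the componentwise positive part of $u$. Let $r_{\rm SALP}$ be (the $r$-component of) an optimal solution of the smoothed approximate linear program $$\max_{r\in\mathbb R^K,\,s\in\mathbb R^{\mathcal X}}\ \nu^\top\Phi r-\frac{2\pi_{\mu^*,\nu}^\top s}{1-\alpha}\quad\text{s.t. } \Phi r\le T\Phi r+s,\ s\ge0,$$ let $\mathcal N\subset\mathbb R^K$ be a set with $r_{\rm SALP}\in\mathcal N$, and suppose that $B=\sup_{r\in\mathcal N}\|(\Phi r-T\Phi r)^+\|_\infty$ is finite. Let $\epsilon\in(0,B]$, $\delta\in(0,1/2]$ and let $S$ be an integer with $$S\ge\frac{64B^2}{\epsilon^2}\Big(2(K+2)\log\frac{16eB}{\epsilon}+\log\frac8\delta\Big).$$ Draw states $x_1,\dots,x_S$ independently from $\pi_{\mu^*,\nu}$, and consider the sampled program $$\max_{r\in\mathcal N,\,s\in\mathbb R^S}\ \nu^\top\Phi r-\frac{2}{(1-\alpha)S}\sum_{i=1}^Ss_i\quad\text{s.t.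 } \Phi r(x_i)\le T\Phi r(x_i)+s_i\ (1\le i\le S),\ s\ge0.$$ Then, with probability at least $1-\delta-2^{-383}\delta^{128}$, every optimal solution $\hat r_{\rm SALP}$ (the $r$-component) of the sampled program satisfies $$\|J^*-\Phi\hat r_{\rm SALP}\|_{1,\nu}\le\inf_{r\in\mathcal N,\ \psi\in\Psi}\|J^*-\Phi r\|_{\infty,\mathbf 1/\psi}\Big(\nu^\top\psi+\frac{2(\pi_{\mu^*,\nu}^\top\psi+1)(\alpha\beta(\psi)+1)}{1-\alpha}\Big)+\frac{4\epsilon}{1-\alpha}.$$ -/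

import Mathlib

open Matrix

/-- A discounted, infinite-horizon, cost-minimising Markov decision process with finite state space
`X` and finite action space `A`: per-stage cost `g x a`, transition probabilities `P a x x'` (from
`x` to `x'` under action `a`), and discount factor `α ∈ (0, 1)`. -/
structure DiscountedMDP (X A : Type*) [Fintype X] where
  /-- per-stage cost -/
  g : X → A → ℝ
  /-- transition probabilities; `P a` is a row-stochastic matrix -/
  P : A → Matrix X X ℝ
  P_nonneg : ∀ a x x', 0 ≤ P a x x'
  P_sum : ∀ a x, ∑ x', P a x x' = 1
  /-- discount factor -/
  α : ℝ
  α_pos : 0 < α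
  α_lt_one : α < 1

namespace DiscountedMDP

noncomputable section

variable {X A : Type*} [Fintype X] (M : DiscountedMDP X A)

/-- The transition matrix `P_μ` of a stationary policy `μ`. -/
def policyP (μ : X → A) : Matrix X X ℝ := Matrix.of fun x x' => M.P (μ x) x x'

/-- The cost vector `g_μ` of a stationary policy `μ`. -/
def policyCost (μ : X → A) : X → ℝ := fun x => M.g x (μ x)

/-- The cost-to-go `J_μ = ∑ₜ αᵗ P_μᵗ g_μ`; here `(P_μᵗ g_μ) x` is the expected cost incurred at
time `t` when the chain starts at `x` and runs under `μ`. -/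
def costToGo [DecidableEq X] (μ : X → A) : X → ℝ := fun x =>
  ∑' t : ℕ, M.α ^ t * ((M.policyP μ ^ t) *ᵥ M.policyCost μ) x

/-- A stationary policy is optimal if it minimises the cost-to-go from every state. -/
def IsOptimalPolicy [DecidableEq X] (μ : X → A) : Prop :=
  ∀ (μ' : X → A) (x : X), M.costToGo μ x ≤ M.costToGo μ' x

/-- The optimal cost-to-go `J* x = min_μ J_μ x`. -/
def optCostToGo [DecidableEq X] [Fintype A] [Nonempty A] : X → ℝ := fun x =>
  Finset.univ.inf' Finset.univ_nonempty fun μ : X → A => M.costToGo μ x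

/-- The Bellman operator `(T J) x = min_a (g x a + α ∑_{x'} P_a(x, x') J x')`. -/
def bellman [Fintype A] [Nonempty A] (J : X → ℝ) : X → ℝ := fun x =>
  Finset.univ.inf' Finset.univ_nonempty fun a : A => M.g x a + M.α * ∑ x', M.P a x x' * J x'

/-- The discounted state-visit distribution `π_{μ,ν} = (1 - α) ∑ₜ αᵗ νᵀ P_μᵗ`. -/
def visitDist [DecidableEq X] (μ : X → A) (ν : X → ℝ) : X → ℝ := fun x =>
  (1 - M.α) * ∑' t : ℕ, M.α ^ t * (ν ᵥ* (M.policyP μ ^ t)) x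

/-- `β(ψ) = max_{x, a} |∑_{x'} P_a(x, x') ψ x' / ψ x|`. -/
def stability [Nonempty X] [Fintype A] [Nonempty A] (ψ : X → ℝ) : ℝ :=
  Finset.univ.sup' Finset.univ_nonempty fun p : X × A =>
    |(∑ x', M.P p.2 p.1 x' * ψ x') / ψ p.1|

end

end DiscountedMDP

noncomputable section

/-- The weighted `1`-norm `‖J‖_{1,ν} = ∑ₓ ν x |J x|`. -/
def weightedOneNorm {X : Type*} [Fintype X] (ν J : X → ℝ) : ℝ := ∑ x, ν x * |J x|

/-- The weighted max-norm `‖J‖_{∞,1/ψ} = maxₓ |J x| / ψ x`. -/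
def weightedMaxNorm {X : Type*} [Fintype X] [Nonempty X] (ψ J : X → ℝ) : ℝ :=
  Finset.univ.sup' Finset.univ_nonempty fun x => |J x| / ψ x

/-- The set `Ψ` of weighting functions `ψ ≥ 1`. -/
def weightingFunctions (X : Type*) : Set (X → ℝ) := {ψ | ∀ x, 1 ≤ ψ x}

namespace DiscountedMDP

variable {X A : Type*} [Fintype X] [DecidableEq X] [Nonempty X] [Fintype A] [Nonempty A]
  (M : DiscountedMDP X A) {K : ℕ} (Φ : Matrix X (Fin K) ℝ) (ν : X → ℝ) (μ : X → A)

/-- The vector `(Φ r - T Φ r)⁺` of Bellman constraint violations. -/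
def violation (r : Fin K → ℝ) : X → ℝ := fun x =>
  max ((Φ *ᵥ r) x - M.bellman (Φ *ᵥ r) x) 0

/-- Feasibility of `(r, s)` for the smoothed approximate linear program (SALP):
`Φ r ≤ T Φ r + s` and `s ≥ 0`. -/
def SALPFeasible (r : Fin K → ℝ) (s : X → ℝ) : Prop :=
  (∀ x, (Φ *ᵥ r) x ≤ M.bellman (Φ *ᵥ r) x + s x) ∧ ∀ x, 0 ≤ s x

/-- The SALP objective `νᵀ Φ r - 2 π_{μ,ν}ᵀ s / (1 - α)`. -/
def SALPObjective (r : Fin K → ℝ) (s : X → ℝ) : ℝ :=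
  ν ⬝ᵥ (Φ *ᵥ r) - 2 * (M.visitDist μ ν ⬝ᵥ s) / (1 - M.α)

/-- `r` is (the weight component of) an optimal solution of the SALP. -/
def IsSALPOptimal (r : Fin K → ℝ) : Prop :=
  ∃ s : X → ℝ, M.SALPFeasible Φ r s ∧
    ∀ (r' : Fin K → ℝ) (s' : X → ℝ), M.SALPFeasible Φ r' s' →
      M.SALPObjective Φ ν μ r' s' ≤ M.SALPObjective Φ ν μ r s

/-- Feasibility of `(r, s)` for the sampled SALP with sampled states `y 0, …, y (S - 1)` (repetitions
are allowed, one slack variable per sample) and bounding set `N`. -/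
def SampledFeasible {S : ℕ} (N : Set (Fin K → ℝ)) (y : Fin S → X)
    (r : Fin K → ℝ) (s : Fin S → ℝ) : Prop :=
  (∀ i, (Φ *ᵥ r) (y i) ≤ M.bellman (Φ *ᵥ r) (y i) + s i) ∧ (∀ i, 0 ≤ s i) ∧ r ∈ N

/-- The sampled SALP objective `νᵀ Φ r - 2 / ((1 - α) S) ∑ᵢ s i`. -/
def SampledObjective {S : ℕ} (r : Fin K → ℝ) (s : Fin S → ℝ) : ℝ :=
  ν ⬝ᵥ (Φ *ᵥ r) - 2 / ((1 - M.α) * S) * ∑ i, s i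

/-- `r` is (the weight component of) an optimal solution of the sampled SALP. -/
def IsSampledSALPOptimal {S : ℕ} (N : Set (Fin K → ℝ)) (y : Fin S → X) (r : Fin K → ℝ) : Prop :=
  ∃ s : Fin S → ℝ, M.SampledFeasible Φ N y r s ∧
    ∀ (r' : Fin K → ℝ) (s' : Fin S → ℝ), M.SampledFeasible Φ N y r' s' →
      M.SampledObjective Φ ν r' s' ≤ M.SampledObjective Φ ν r s

/-- `‖J* - Φ r‖_{∞,1/ψ} (νᵀ ψ + 2 (π_{μ,ν}ᵀ ψ + 1) (α β(ψ) + 1) / (1 - α))`. -/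
def approxBound (r : Fin K → ℝ) (ψ : X → ℝ) : ℝ :=
  weightedMaxNorm ψ (M.optCostToGo - Φ *ᵥ r) *
    (ν ⬝ᵥ ψ + 2 * (M.visitDist μ ν ⬝ᵥ ψ + 1) * (M.α * M.stability ψ + 1) / (1 - M.α))

end DiscountedMDP

end

/-! Write `J = Φ r`. The error splits as `|J* - J| = (J* - J) + 2 (J - J*)⁺`, and the balance
equation of the discounted visit distribution bounds the `ν`-mean of `(J - J*)⁺` by the mean, under
that distribution, of the Bellman violation of the single policy `μ*`
(`IsOptimalPolicy.weightedOneNorm_le`). The minimum over actions is not needed there. The violation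
of one policy is the positive part of an affine function of `r`, so its superlevel sets have VC
dimension at most `K + 1`, whatever the numbers of states and actions.

Sampling enters through two one-sided events. For the optimiser `r̂` of the sampled program, which
depends on the sample, the true mean of the policy violation must exceed the empirical one by at
most `ε`, uniformly in `r ∈ N`. This is `measureReal_policyViolation_deviation_le`: symmetrisation
against a ghost sample inside an exponential moment, Sauer-Shelah counting, and a layer-cake
integral to pass from sets to functions. For the fixed `rSALP` the empirical mean of the full
violation must exceed the true one by at most `ε`, which is Hoeffding's inequality. Each event fails
with probability at most `δ / 2`.

When both hold, optimality of `r̂` in the sampled program and of `rSALP` in the SALP chains the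
objectives together, at a cost of `2 ε / (1 - α)` for each exchange of means. What remains is the
SALP optimality gap, bounded by the approximation error in
`IsOptimalPolicy.sub_SALPObjective_le_approxBound`. -/

set_option linter.unusedSectionVars false

namespace DiscountedMDP

/-! ### Fixed policies: cost-to-go and discounted visit distribution. -/

section Deterministic

variable {X A : Type*} [Fintype X] (M : DiscountedMDP X A)

/-- A function which is dominated by its own discounted expected value is nonpositive. -/
theorem nonpos_of_le_discounted [Nonempty X] {μ : X → A} {u : X → ℝ}
    (hu : ∀ x, u x ≤ M.α * ∑ x', M.P (μ x) x x' * u x') (x : X) : u x ≤ 0 := by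
  -- At a maximiser `m` the average of `u` is at most `u m`, so `u m ≤ α u m` with `α < 1`.
  obtain ⟨m, hm⟩ := Finite.exists_max u
  have h1 : ∑ x', M.P (μ m) m x' * u x' ≤ u m := by
    calc ∑ x', M.P (μ m) m x' * u x' ≤ ∑ x', M.P (μ m) m x' * u m :=
          Finset.sum_le_sum fun y _ => mul_le_mul_of_nonneg_left (hm y) (M.P_nonneg _ _ _)
      _ = u m := by rw [← Finset.sum_mul, M.P_sum, one_mul]
  have h2 := hu m
  have h3 := mul_le_mul_of_nonneg_left h1 M.α_pos.le
  have h4 := M.α_lt_one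
  have : u m ≤ 0 := by nlinarith
  exact (hm x).trans this

variable [DecidableEq X]

theorem abs_policyP_pow_mulVec_le (μ : X → A) {f : X → ℝ} {C : ℝ} (hf : ∀ x, |f x| ≤ C) (t : ℕ)
    (x : X) : |((M.policyP μ ^ t) *ᵥ f) x| ≤ C := by
  induction t generalizing x with
  | zero => simpa using hf x
  | succ t ih =>
    rw [pow_succ', ← mulVec_mulVec]
    calc |∑ y, M.policyP μ x y * ((M.policyP μ ^ t) *ᵥ f) y|
        ≤ ∑ y, |M.policyP μ x y * ((M.policyP μ ^ t) *ᵥ f) y| := Finset.abs_sum_le_sum_abs _ _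
      _ ≤ ∑ y, M.P (μ x) x y * C := by
          refine Finset.sum_le_sum fun y _ => ?_
          rw [abs_mul, policyP, of_apply, abs_of_nonneg (M.P_nonneg _ _ _)]
          exact mul_le_mul_of_nonneg_left (ih y) (M.P_nonneg _ _ _)
      _ = C := by rw [← Finset.sum_mul, M.P_sum, one_mul]

theorem summable_discounted {a : ℕ → ℝ} {C : ℝ} (ha : ∀ t, |a t| ≤ C) :
    Summable fun t => M.α ^ t * a t := by
  refine Summable.of_norm_bounded
    ((summable_geometric_of_lt_one M.α_pos.le M.α_lt_one).mul_right C) fun t => ?_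
  rw [norm_mul, Real.norm_eq_abs, Real.norm_eq_abs, abs_of_nonneg (pow_nonneg M.α_pos.le t)]
  exact mul_le_mul_of_nonneg_left (ha t) (pow_nonneg M.α_pos.le t)

/-- The cost-to-go of a policy is a fixed point of its Bellman operator. -/
theorem costToGo_eq (μ : X → A) (x : X) :
    M.costToGo μ x = M.g x (μ x) + M.α * ∑ x', M.P (μ x) x x' * M.costToGo μ x' := by
  obtain ⟨C, hC⟩ : ∃ C, ∀ x, |M.policyCost μ x| ≤ C :=
    ⟨∑ y, |M.policyCost μ y|, fun x => Finset.single_le_sum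
      (f := fun y => |M.policyCost μ y|) (fun _ _ => abs_nonneg _) (Finset.mem_univ x)⟩
  have hs : ∀ y, Summable fun t => M.α ^ t * ((M.policyP μ ^ t) *ᵥ M.policyCost μ) y :=
    fun y => M.summable_discounted fun t => M.abs_policyP_pow_mulVec_le μ hC t y
  unfold costToGo
  rw [(hs x).tsum_eq_zero_add]
  congr 1
  · simp [policyCost]
  · rw [Finset.mul_sum]
    simp_rw [← tsum_mul_left]
    rw [← Summable.tsum_finsetSum fun y _ => ((hs y).mul_left _).mul_left _]
    refine tsum_congr fun t => ?_
    rw [pow_succ' (M.policyP μ), ← mulVec_mulVec, pow_succ']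
    simp only [mulVec, dotProduct, Finset.mul_sum, policyP, of_apply]
    refine Finset.sum_congr rfl fun y _ => Finset.sum_congr rfl fun z _ => by ring

theorem vecMul_policyP_pow_nonneg (μ : X → A) {ν : X → ℝ} (hν : ∀ x, 0 ≤ ν x) (t : ℕ) (x : X) :
    0 ≤ (ν ᵥ* (M.policyP μ ^ t)) x := by
  induction t generalizing x with
  | zero => simpa using hν x
  | succ t ih =>
    rw [pow_succ, ← vecMul_vecMul]
    exact Finset.sum_nonneg fun y _ => mul_nonneg (ih y) (M.P_nonneg _ _ _)

theorem sum_vecMul_policyP_pow (μ : X → A) (ν : X → ℝ) (t : ℕ) :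
    ∑ x, (ν ᵥ* (M.policyP μ ^ t)) x = ∑ x, ν x := by
  induction t with
  | zero => simp
  | succ t ih =>
    rw [pow_succ, ← vecMul_vecMul, ← ih]
    simp only [vecMul, dotProduct]
    rw [Finset.sum_comm]
    refine Finset.sum_congr rfl fun y _ => ?_
    rw [← Finset.mul_sum]
    simp [policyP, M.P_sum]

/-- The discounted state-visit distribution solves the discounted balance equation. -/
theorem visitDist_eq (μ : X → A) {ν : X → ℝ} (hν : ∀ x, 0 ≤ ν x) (x : X) :
    M.visitDist μ ν x =
      (1 - M.α) * ν x + M.α * ∑ y, M.visitDist μ ν y * M.P (μ y) y x := by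
  have hs : ∀ y, Summable fun t => M.α ^ t * (ν ᵥ* (M.policyP μ ^ t)) y := by
    refine fun y => M.summable_discounted (C := ∑ x, ν x) fun t => ?_
    rw [abs_of_nonneg (M.vecMul_policyP_pow_nonneg μ hν t y), ← M.sum_vecMul_policyP_pow μ ν t]
    exact Finset.single_le_sum (f := fun x => (ν ᵥ* (M.policyP μ ^ t)) x)
      (fun x _ => M.vecMul_policyP_pow_nonneg μ hν t x) (Finset.mem_univ y)
  have key : ∑' t : ℕ, M.α ^ t * (ν ᵥ* (M.policyP μ ^ t)) x = ν x +
      M.α * ∑ y, (∑' t : ℕ, M.α ^ t * (ν ᵥ* (M.policyP μ ^ t)) y) * M.P (μ y) y x := by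
    rw [(hs x).tsum_eq_zero_add]
    congr 1
    · simp
    · rw [Finset.mul_sum]
      simp_rw [← tsum_mul_right, ← tsum_mul_left]
      rw [← Summable.tsum_finsetSum fun y _ => ((hs y).mul_right _).mul_left _]
      refine tsum_congr fun t => ?_
      rw [pow_succ (M.policyP μ), ← vecMul_vecMul, pow_succ']
      simp only [vecMul, dotProduct, Finset.mul_sum, Finset.sum_mul, policyP, of_apply]
      refine Finset.sum_congr rfl fun y _ => Finset.sum_congr rfl fun z _ => by ring
  unfold visitDist
  rw [key, mul_add]
  congr 1
  simp only [Finset.mul_sum]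
  refine Finset.sum_congr rfl fun y _ => by ring

theorem visitDist_nonneg (μ : X → A) {ν : X → ℝ} (hν : ∀ x, 0 ≤ ν x) (x : X) :
    0 ≤ M.visitDist μ ν x :=
  mul_nonneg (sub_nonneg.2 M.α_lt_one.le) <| tsum_nonneg fun t =>
    mul_nonneg (pow_nonneg M.α_pos.le t) (M.vecMul_policyP_pow_nonneg μ hν t x)

/-- If `u ≤ α P_μ u + w` with `w ≥ 0`, then `(1 - α) νᵀ u⁺ ≤ π_{μ,ν}ᵀ w`. -/
theorem dotProduct_pos_le_visitDist (μ : X → A) {ν : X → ℝ} (hν : ∀ x, 0 ≤ ν x) {u w : X → ℝ}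
    (hw : ∀ x, 0 ≤ w x) (hu : ∀ x, u x ≤ M.α * ∑ x', M.P (μ x) x x' * u x' + w x) :
    (1 - M.α) * ∑ x, ν x * max (u x) 0 ≤ ∑ x, M.visitDist μ ν x * w x := by
  -- The inequality passes to positive parts because `P` and `w` are nonnegative.
  have h1 : ∀ x, max (u x) 0 ≤ M.α * ∑ x', M.P (μ x) x x' * max (u x') 0 + w x := by
    intro x
    refine max_le ((hu x).trans ?_) ?_
    · have : ∑ x', M.P (μ x) x x' * u x' ≤ ∑ x', M.P (μ x) x x' * max (u x') 0 :=
        Finset.sum_le_sum fun y _ => mul_le_mul_of_nonneg_left (le_max_left _ _) (M.P_nonneg _ _ _)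
      have := mul_le_mul_of_nonneg_left this M.α_pos.le
      linarith
    · exact add_nonneg (mul_nonneg M.α_pos.le (Finset.sum_nonneg fun y _ =>
        mul_nonneg (M.P_nonneg _ _ _) (le_max_right _ _))) (hw x)
  have h2 : ∑ x, M.visitDist μ ν x * max (u x) 0 ≤
      ∑ x, M.visitDist μ ν x * (M.α * ∑ x', M.P (μ x) x x' * max (u x') 0 + w x) :=
    Finset.sum_le_sum fun x _ => mul_le_mul_of_nonneg_left (h1 x) (M.visitDist_nonneg μ hν x)
  -- By the balance equation, the discounted term here is the one in `h2`, so the two cancel.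
  have h3 : ∑ x, M.visitDist μ ν x * max (u x) 0 = (1 - M.α) * ∑ x, ν x * max (u x) 0 +
      ∑ x, M.visitDist μ ν x * (M.α * ∑ x', M.P (μ x) x x' * max (u x') 0) := by
    calc ∑ x, M.visitDist μ ν x * max (u x) 0
        = ∑ x, ((1 - M.α) * ν x + M.α * ∑ y, M.visitDist μ ν y * M.P (μ y) y x) *
            max (u x) 0 := by
          refine Finset.sum_congr rfl fun x _ => ?_
          rw [← M.visitDist_eq μ hν]
      _ = _ := by
          simp only [add_mul, Finset.sum_add_distrib, Finset.mul_sum, Finset.sum_mul]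
          congr 1
          · refine Finset.sum_congr rfl fun x _ => by ring
          · rw [Finset.sum_comm]
            refine Finset.sum_congr rfl fun x _ => Finset.sum_congr rfl fun y _ => by ring
  simp only [mul_add, Finset.sum_add_distrib] at h2
  linarith

/-! ### The Bellman operator, constraint violations and the approximation error. -/

variable [Fintype A] [Nonempty A]

theorem bellman_le (J : X → ℝ) (x : X) (a : A) :
    M.bellman J x ≤ M.g x a + M.α * ∑ x', M.P a x x' * J x' :=
  Finset.inf'_le _ (Finset.mem_univ a)

theorem exists_bellman_eq (J : X → ℝ) (x : X) :
    ∃ a, M.bellman J x = M.g x a + M.α * ∑ x', M.P a x x' * J x' := by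
  obtain ⟨a, -, ha⟩ := Finset.exists_mem_eq_inf' (Finset.univ_nonempty (α := A))
    fun a : A => M.g x a + M.α * ∑ x', M.P a x x' * J x'
  exact ⟨a, ha⟩

theorem IsOptimalPolicy.optCostToGo_eq {M : DiscountedMDP X A} {μ : X → A}
    (hμ : M.IsOptimalPolicy μ) : M.optCostToGo = M.costToGo μ := by
  funext x
  exact le_antisymm (Finset.inf'_le _ (Finset.mem_univ μ))
    (Finset.le_inf' _ _ fun μ' _ => hμ μ' x)

/-- The cost-to-go of an optimal policy satisfies `J* ≤ T J*`. -/
theorem IsOptimalPolicy.costToGo_le_bellman [Nonempty X] {M : DiscountedMDP X A} {μ : X → A}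
    (hμ : M.IsOptimalPolicy μ) (x : X) : M.costToGo μ x ≤ M.bellman (M.costToGo μ) x := by
  -- Policy improvement: the policy greedy for `J_μ` costs no more than `μ`, hence exactly as much
  -- by optimality, and `T J_μ` is then its own fixed-point equation.
  choose μ' hμ' using M.exists_bellman_eq (M.costToGo μ)
  have h : ∀ y, M.costToGo μ' y - M.costToGo μ y ≤ 0 := by
    refine M.nonpos_of_le_discounted (μ := μ') (u := fun y => M.costToGo μ' y - M.costToGo μ y)
      fun y => ?_
    have h1 := M.bellman_le (M.costToGo μ) y (μ y)
    rw [← M.costToGo_eq, hμ'] at h1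
    have h2 := M.costToGo_eq μ' y
    simp only [mul_sub, Finset.sum_sub_distrib]
    linarith
  have he : M.costToGo μ' = M.costToGo μ :=
    funext fun y => le_antisymm (by linarith [h y]) (hμ μ' y)
  rw [hμ' x, ← he, ← M.costToGo_eq]

/-- The action attaining the minimum for `J'` is a competitor for `J`, and one transition step
inflates `ψ` by at most the factor `β(ψ)`. -/
theorem bellman_sub_le [Nonempty X] {J J' ψ : X → ℝ} {η : ℝ} (hη : 0 ≤ η) (hψ : ∀ x, 0 < ψ x)
    (h : ∀ x, J x ≤ J' x + η * ψ x) (x : X) :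
    M.bellman J x ≤ M.bellman J' x + M.α * (η * (M.stability ψ * ψ x)) := by
  obtain ⟨a, ha⟩ := M.exists_bellman_eq J' x
  have h1 := M.bellman_le J x a
  have h2 : ∑ x', M.P a x x' * J x' ≤ ∑ x', M.P a x x' * J' x' + η * ∑ x', M.P a x x' * ψ x' := by
    rw [Finset.mul_sum, ← Finset.sum_add_distrib]
    refine Finset.sum_le_sum fun y _ => ?_
    have := mul_le_mul_of_nonneg_left (h y) (M.P_nonneg a x y)
    linarith
  have h3 : ∑ x', M.P a x x' * ψ x' ≤ M.stability ψ * ψ x := by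
    rw [← div_le_iff₀ (hψ x)]
    exact (le_abs_self _).trans (Finset.le_sup' (fun p : X × A =>
      |(∑ x', M.P p.2 p.1 x' * ψ x') / ψ p.1|) (Finset.mem_univ (x, a)))
  have h4 := mul_le_mul_of_nonneg_left (h2.trans (add_le_add_right
    (mul_le_mul_of_nonneg_left h3 hη) _)) M.α_pos.le
  linarith

theorem stability_nonneg [Nonempty X] (ψ : X → ℝ) : 0 ≤ M.stability ψ := by
  obtain ⟨x⟩ := ‹Nonempty X›
  obtain ⟨a⟩ := ‹Nonempty A›
  exact (abs_nonneg _).trans (Finset.le_sup' (fun p : X × A =>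
      |(∑ x', M.P p.2 p.1 x' * ψ x') / ψ p.1|) (Finset.mem_univ (x, a)))

variable {K : ℕ} (Φ : Matrix X (Fin K) ℝ)

theorem violation_nonneg (r : Fin K → ℝ) (x : X) : 0 ≤ M.violation Φ r x := le_max_right _ _

/-- Together with `violation_le`, this makes the violation the least feasible slack for `r`. -/
theorem SALPFeasible_violation (r : Fin K → ℝ) : M.SALPFeasible Φ r (M.violation Φ r) :=
  ⟨fun x => by linarith [le_max_left ((Φ *ᵥ r) x - M.bellman (Φ *ᵥ r) x) 0,
    show M.violation Φ r x = max ((Φ *ᵥ r) x - M.bellman (Φ *ᵥ r) x) 0 from rfl],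
    M.violation_nonneg Φ r⟩

theorem violation_le {r : Fin K → ℝ} {x : X} {c : ℝ}
    (h : (Φ *ᵥ r) x ≤ M.bellman (Φ *ᵥ r) x + c) (hc : 0 ≤ c) : M.violation Φ r x ≤ c :=
  max_le (by linarith) hc

theorem abs_le_weightedMaxNorm_mul [Nonempty X] {ψ : X → ℝ} (hψ : ∀ x, 0 < ψ x) (J : X → ℝ)
    (x : X) : |J x| ≤ weightedMaxNorm ψ J * ψ x := by
  rw [← div_le_iff₀ (hψ x)]
  exact Finset.le_sup' (fun x => |J x| / ψ x) (Finset.mem_univ x)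

theorem weightedMaxNorm_nonneg [Nonempty X] {ψ : X → ℝ} (hψ : ∀ x, 0 < ψ x) (J : X → ℝ) :
    0 ≤ weightedMaxNorm ψ J := by
  obtain ⟨x⟩ := ‹Nonempty X›
  exact (div_nonneg (abs_nonneg _) (hψ x).le).trans
    (Finset.le_sup' (fun x => |J x| / ψ x) (Finset.mem_univ x))

/-- The SALP optimality gap of `r` relative to `νᵀ J*` is controlled by the approximation error. -/
theorem IsOptimalPolicy.sub_SALPObjective_le_approxBound [Nonempty X] {M : DiscountedMDP X A}
    {μ : X → A} (hμ : M.IsOptimalPolicy μ) {ν : X → ℝ} (hν : ∀ x, 0 ≤ ν x) (r : Fin K → ℝ)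
    {ψ : X → ℝ} (hψ : ∀ x, 1 ≤ ψ x) :
    ν ⬝ᵥ M.optCostToGo - M.SALPObjective Φ ν μ r (M.violation Φ r) ≤ M.approxBound Φ ν μ r ψ := by
  have hψ0 : ∀ x, 0 < ψ x := fun x => one_pos.trans_le (hψ x)
  set η := weightedMaxNorm ψ (M.optCostToGo - Φ *ᵥ r) with hη
  have hη0 : 0 ≤ η := weightedMaxNorm_nonneg hψ0 _
  have hβ := M.stability_nonneg ψ
  have hα := sub_pos.2 M.α_lt_one
  have hd : ∀ x, |M.optCostToGo x - (Φ *ᵥ r) x| ≤ η * ψ x :=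
    fun x => abs_le_weightedMaxNorm_mul hψ0 (M.optCostToGo - Φ *ᵥ r) x
  -- Compare through `J*`: `Φ r ≤ J* + η ψ ≤ T J* + η ψ ≤ T Φ r + α η β(ψ) ψ + η ψ`.
  have hv : ∀ x, M.violation Φ r x ≤ η * (M.α * M.stability ψ + 1) * ψ x := by
    intro x
    refine M.violation_le Φ ?_ ?_
    · have h1 := hμ.costToGo_le_bellman x
      rw [← hμ.optCostToGo_eq] at h1
      have h2 := M.bellman_sub_le hη0 hψ0 (J := M.optCostToGo) (J' := Φ *ᵥ r)
        (fun y => by linarith [(abs_le.1 (hd y)).2]) x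
      have h3 := (abs_le.1 (hd x)).1
      linarith
    · have := M.α_pos
      have := hψ0 x
      positivity
  have h1 : ν ⬝ᵥ M.optCostToGo - ν ⬝ᵥ (Φ *ᵥ r) ≤ η * (ν ⬝ᵥ ψ) := by
    simp only [dotProduct, Finset.mul_sum, ← Finset.sum_sub_distrib]
    refine Finset.sum_le_sum fun x _ => ?_
    have := mul_le_mul_of_nonneg_left (abs_le.1 (hd x)).2 (hν x)
    linarith
  have h2 : M.visitDist μ ν ⬝ᵥ M.violation Φ r ≤
      η * (M.α * M.stability ψ + 1) * (M.visitDist μ ν ⬝ᵥ ψ + 1) := by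
    have : M.visitDist μ ν ⬝ᵥ M.violation Φ r ≤
        η * (M.α * M.stability ψ + 1) * (M.visitDist μ ν ⬝ᵥ ψ) := by
      simp only [dotProduct, Finset.mul_sum]
      refine Finset.sum_le_sum fun x _ => ?_
      have := mul_le_mul_of_nonneg_left (hv x) (M.visitDist_nonneg μ hν x)
      linarith
    have h0 : 0 ≤ η * (M.α * M.stability ψ + 1) := by
      have := M.α_pos
      positivity
    linarith
  have h3 := div_le_div_of_nonneg_right (mul_le_mul_of_nonneg_left h2 zero_le_two) hα.le
  unfold SALPObjective approxBound
  rw [← hη, mul_add]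
  have h4 : η * (2 * (M.visitDist μ ν ⬝ᵥ ψ + 1) * (M.α * M.stability ψ + 1) / (1 - M.α)) =
      2 * (η * (M.α * M.stability ψ + 1) * (M.visitDist μ ν ⬝ᵥ ψ + 1)) / (1 - M.α) := by ring
  rw [h4]
  linarith

/-- The positive part `(J - T_μ J)⁺` at `J = Φ r` of the violation of the Bellman inequality of the
single policy `μ`. -/
noncomputable def policyViolation (μ : X → A) (r : Fin K → ℝ) : X → ℝ := fun x =>
  max ((Φ *ᵥ r) x - (M.g x (μ x) + M.α * ∑ x', M.P (μ x) x x' * (Φ *ᵥ r) x')) 0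

theorem policyViolation_nonneg (μ : X → A) (r : Fin K → ℝ) (x : X) :
    0 ≤ M.policyViolation Φ μ r x := le_max_right _ _

/-- Transfers to the policy violation both the bound `B` and domination by any feasible slack. -/
theorem policyViolation_le_violation (μ : X → A) (r : Fin K → ℝ) (x : X) :
    M.policyViolation Φ μ r x ≤ M.violation Φ r x :=
  max_le_max_right _ (sub_le_sub_left (M.bellman_le _ x (μ x)) _)

/-- Since `J*` is a fixed point of the operator of `μ`, the difference `Φ r - J*` satisfies `u ≤ α
P_μ u + w` with `w` the policy violation, and `dotProduct_pos_le_visitDist` applies. -/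
theorem IsOptimalPolicy.weightedOneNorm_le {M : DiscountedMDP X A}
    {μ : X → A} (hμ : M.IsOptimalPolicy μ) {ν : X → ℝ} (hν : ∀ x, 0 ≤ ν x) (r : Fin K → ℝ) :
    weightedOneNorm ν (M.optCostToGo - Φ *ᵥ r) ≤ ν ⬝ᵥ M.optCostToGo -
      (ν ⬝ᵥ (Φ *ᵥ r) - 2 * (M.visitDist μ ν ⬝ᵥ M.policyViolation Φ μ r) / (1 - M.α)) := by
  have hα := sub_pos.2 M.α_lt_one
  have h := M.dotProduct_pos_le_visitDist μ hν (u := fun x => (Φ *ᵥ r) x - M.optCostToGo x)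
    (w := M.policyViolation Φ μ r) (M.policyViolation_nonneg Φ μ r) (fun x => by
      have h1 := M.costToGo_eq μ x
      have h2 : _ ≤ M.policyViolation Φ μ r x := le_max_left _ _
      rw [hμ.optCostToGo_eq]
      simp only [mul_sub, Finset.sum_sub_distrib]
      linarith)
  rw [mul_comm, ← le_div_iff₀ hα] at h
  have h1 : weightedOneNorm ν (M.optCostToGo - Φ *ᵥ r) = ν ⬝ᵥ M.optCostToGo - ν ⬝ᵥ (Φ *ᵥ r) +
      2 * ∑ x, ν x * max ((Φ *ᵥ r) x - M.optCostToGo x) 0 := by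
    simp only [weightedOneNorm, dotProduct, Finset.mul_sum, ← Finset.sum_sub_distrib,
      ← Finset.sum_add_distrib, Pi.sub_apply]
    refine Finset.sum_congr rfl fun x _ => ?_
    rcases le_total ((Φ *ᵥ r) x) (M.optCostToGo x) with hx | hx
    · rw [abs_of_nonneg (by linarith), max_eq_right (by linarith)]
      ring
    · rw [abs_of_nonpos (by linarith), max_eq_left (by linarith)]
      ring
  rw [h1, mul_div_assoc]
  simp only [dotProduct] at h ⊢
  linarith

end Deterministic

end DiscountedMDP

/-! ### VC dimension, symmetrisation and uniform deviations over finite spaces. -/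

section VapnikChervonenkis

/-- Positivity sets of an affine family with `κ` parameters have VC dimension at most `card κ`. -/
theorem vcDim_le_of_affine {ι κ : Type*} [DecidableEq ι] [Fintype κ] (F : ι → κ → ℝ) (G : ι → ℝ)
    (𝒯 : Finset (Finset ι))
    (h𝒯 : ∀ s ∈ 𝒯, ∃ θ : κ → ℝ, ∀ i, i ∈ s ↔ G i < ∑ k, θ k * F i k) :
    𝒯.vcDim ≤ Fintype.card κ := by
  refine Finset.sup_le fun s hs => ?_
  rw [Finset.mem_shatterer] at hs
  by_contra! hcard
  have hdep : ¬ LinearIndependent ℝ fun i : s => F i := by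
    intro h
    have := h.fintype_card_le_finrank
    simp only [Module.finrank_fintype_fun_eq_card, Fintype.card_coe] at this
    omega
  obtain ⟨c, hc, i₀, hi₀⟩ := Fintype.not_linearIndependent_iff.1 hdep
  -- Shattering provides a parameter whose positivity set on `s` is `{i | 0 < c i}`. Pairing its
  -- inequalities with `c` kills the linear part and forces a sign on `∑ c i * G i`. Applying this
  -- to `c` and `-c` is contradictory.
  have key : ∀ c : s → ℝ, ∑ i, c i • F i = 0 →
      ∑ i, c i * G i ≤ 0 ∧ ((∃ i, 0 < c i) → ∑ i, c i * G i < 0) := by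
    intro c hc
    obtain ⟨t, ht, hst⟩ := hs (t := (Finset.univ.filter fun i : s => 0 < c i).map
      (Function.Embedding.subtype _)) (by
        intro i hi
        simp only [Finset.mem_map, Finset.mem_filter] at hi
        obtain ⟨a, -, rfl⟩ := hi
        exact a.2)
    obtain ⟨θ, hθ⟩ := h𝒯 t ht
    have hmem : ∀ i : s, (0 < c i ↔ G i < ∑ k, θ k * F i k) := by
      intro i
      rw [← hθ i]
      have h1 : (i : ι) ∈ s ∩ t ↔ 0 < c i := by
        rw [hst]
        simp
      rw [← h1]
      simp
    have hzero : ∑ i, c i * ∑ k, θ k * F i k = 0 := by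
      have h2 : ∀ k, ∑ i, c i * F i k = 0 := fun k => by
        simpa [Finset.sum_apply] using congrFun hc k
      calc ∑ i, c i * ∑ k, θ k * F i k = ∑ k, θ k * ∑ i, c i * F i k := by
            simp only [Finset.mul_sum]
            rw [Finset.sum_comm]
            refine Finset.sum_congr rfl fun k _ => Finset.sum_congr rfl fun i _ => by ring
        _ = 0 := Finset.sum_eq_zero fun k _ => by rw [h2, mul_zero]
    have hle : ∀ i ∈ Finset.univ, c i * G i ≤ c i * ∑ k, θ k * F i k := by
      intro i _
      by_cases hi : 0 < c i
      · exact mul_le_mul_of_nonneg_left ((hmem i).1 hi).le hi.le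
      · exact mul_le_mul_of_nonpos_left (not_lt.1 fun h => hi ((hmem i).2 h)) (not_lt.1 hi)
    exact ⟨(Finset.sum_le_sum hle).trans_eq hzero, fun ⟨j, hj⟩ => (Finset.sum_lt_sum hle
      ⟨j, Finset.mem_univ j, mul_lt_mul_of_pos_left ((hmem j).1 hj) hj⟩).trans_eq hzero⟩
  have hc' : ∀ c : s → ℝ, ∑ i, c i • F i = 0 → ∑ i, (-c i) • F i = 0 := fun c hc => by
    simp only [neg_smul, Finset.sum_neg_distrib, hc, neg_zero]
  have hneg : ∀ c : s → ℝ, ∑ i, c i • F i = 0 → ¬ ∃ i, 0 < c i := by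
    intro c hc hpos
    have h1 := (key c hc).2 hpos
    have h2 := (key (fun i => -c i) (hc' c hc)).1
    simp only [neg_mul, Finset.sum_neg_distrib] at h2
    linarith
  rcases hi₀.lt_or_gt with h | h
  · exact hneg (fun i => -c i) (hc' c hc) ⟨i₀, by simpa using h⟩
  · exact hneg c hc ⟨i₀, h⟩

/-- A Chernoff-type bound on the partial sums of binomial coefficients. -/
theorem sum_choose_le_exp (n d : ℕ) {x : ℝ} (hx : 0 < x) (hx1 : x ≤ 1) :
    ((∑ k ∈ Finset.Iic d, n.choose k : ℕ) : ℝ) ≤ Real.exp (n * x) * (x ^ d)⁻¹ := by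
  rw [← div_eq_mul_inv, le_div_iff₀ (pow_pos hx d)]
  push_cast
  rw [Finset.sum_mul]
  -- For `k ≤ d` one has `x ^ d ≤ x ^ k`, and the full sum is `(1 + x) ^ n`. Leaving `x` free allows
  -- the growth in `n` to be absorbed later by the exponential tail.
  calc ∑ k ∈ Finset.Iic d, (n.choose k : ℝ) * x ^ d
      ≤ ∑ k ∈ Finset.Iic d, (n.choose k : ℝ) * x ^ k := by
        refine Finset.sum_le_sum fun k hk => mul_le_mul_of_nonneg_left ?_ (Nat.cast_nonneg _)
        exact pow_le_pow_of_le_one hx.le hx1 (Finset.mem_Iic.1 hk)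
    _ ≤ ∑ k ∈ Finset.range (max n d + 1), (n.choose k : ℝ) * x ^ k := by
        refine Finset.sum_le_sum_of_subset_of_nonneg (fun k hk => ?_) fun k _ _ => by positivity
        simp only [Finset.mem_Iic, Finset.mem_range] at hk ⊢
        omega
    _ = ∑ k ∈ Finset.range (n + 1), (n.choose k : ℝ) * x ^ k := by
        refine (Finset.sum_subset (fun k hk => ?_) fun k _ hk => ?_).symm
        · simp only [Finset.mem_range] at hk ⊢
          omega
        · rw [Nat.choose_eq_zero_of_lt (by simpa using hk)]
          simp
    _ = (x + 1) ^ n := by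
        rw [add_pow]
        refine Finset.sum_congr rfl fun k _ => by simp [mul_comm]
    _ ≤ Real.exp x ^ n := pow_le_pow_left₀ (by positivity) (Real.add_one_le_exp x) n
    _ = Real.exp (n * x) := (Real.exp_nat_mul x n).symm

open Classical in
/-- The `0`-`1` indicator of membership in a finite set. -/
noncomputable def memIndicator {X : Type*} (E : Finset X) (x : X) : ℝ := if x ∈ E then 1 else 0

theorem memIndicator_nonneg {X : Type*} (E : Finset X) (x : X) : 0 ≤ memIndicator E x := by
  unfold memIndicator; split_ifs <;> simp

theorem memIndicator_le_one {X : Type*} (E : Finset X) (x : X) : memIndicator E x ≤ 1 := by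
  unfold memIndicator; split_ifs <;> simp

open Classical in
/-- The vectors of differences of indicators over a paired sample, one for each set of a family. -/
noncomputable def diffTraces {X : Type*} {S : ℕ} (𝒜 : Finset (Finset X)) (z : Fin S → X × X) :
    Finset (Fin S → ℝ) :=
  𝒜.image fun E i => memIndicator E (z i).2 - memIndicator E (z i).1

/-- The sign `±1` attached to a Boolean. -/
def boolSign (b : Bool) : ℝ := if b then -1 else 1

/-- Exchanging a point with its ghost flips the sign of that coordinate, and flipping fixed signs is
injective on difference vectors. -/
theorem diffTraces_swap {X : Type*} {S : ℕ} (𝒜 : Finset (Finset X)) (z : Fin S → X × X)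
    (σ : Fin S → Bool) {β : Type*} [AddCommMonoid β] (f : (Fin S → ℝ) → β) :
    ∑ d ∈ diffTraces 𝒜 (fun i => if σ i then (z i).swap else z i), f d =
      ∑ d ∈ diffTraces 𝒜 z, f (fun i => boolSign (σ i) * d i) := by
  classical
  have h : diffTraces 𝒜 (fun i => if σ i then (z i).swap else z i) =
      (diffTraces 𝒜 z).image fun d i => boolSign (σ i) * d i := by
    unfold diffTraces
    rw [Finset.image_image]
    refine Finset.image_congr fun E _ => ?_
    funext i
    cases hσ : σ i <;> simp [boolSign, hσ]
  rw [h, Finset.sum_image]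
  intro d _ d' _ hdd
  funext i
  have := congrFun hdd i
  cases hσ : σ i <;> simpa [boolSign, hσ] using this

/-- Averaging over independent signs. -/
theorem sum_sign_exp_le {S : ℕ} (ε : ℝ) {d : Fin S → ℝ} (hd : ∀ i, |d i| ≤ 1) :
    ∑ σ : Fin S → Bool, Real.exp (∑ i, ε * (boolSign (σ i) * d i)) ≤
      2 ^ S * Real.exp (S * ε ^ 2 / 2) := by
  calc ∑ σ : Fin S → Bool, Real.exp (∑ i, ε * (boolSign (σ i) * d i))
      = ∏ i, ∑ b : Bool, Real.exp (ε * (boolSign b * d i)) := by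
        rw [Finset.prod_univ_sum, Fintype.piFinset_univ]
        exact Finset.sum_congr rfl fun σ _ => Real.exp_sum _ _
    _ ≤ ∏ _i : Fin S, 2 * Real.exp (ε ^ 2 / 2) := by
        refine Finset.prod_le_prod (fun i _ => by positivity) fun i _ => ?_
        have h1 := Real.cosh_le_exp_half_sq (ε * d i)
        rw [Real.cosh_eq] at h1
        have h2 : (ε * d i) ^ 2 / 2 ≤ ε ^ 2 / 2 := by
          rw [mul_pow]
          have : d i ^ 2 ≤ 1 := (sq_le_one_iff_abs_le_one _).2 (hd i)
          nlinarith [sq_nonneg ε]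
        have h3 := Real.exp_le_exp.2 h2
        have h4 : Real.exp (ε * (boolSign true * d i)) = Real.exp (-(ε * d i)) := by
          congr 1; simp [boolSign]
        have h5 : Real.exp (ε * (boolSign false * d i)) = Real.exp (ε * d i) := by
          congr 1; simp [boolSign]
        rw [Fintype.sum_bool, h4, h5]
        linarith
    _ = 2 ^ S * Real.exp (S * ε ^ 2 / 2) := by
        rw [Finset.prod_const, mul_pow, Finset.card_univ, Fintype.card_fin, ← Real.exp_nat_mul]
        congr 2; ring

variable {X : Type*} [Fintype X]

/-- The paired product law is invariant under coordinate swaps, so the sum may be averaged over all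
sign patterns. For each of the at most `C` difference vectors that average is subgaussian. Summing
over distinct vectors instead of sets keeps `C` independent of the size of the family. -/
theorem sum_paired_exp_le (p : X → ℝ) (hp : ∀ x, 0 ≤ p x) (hp1 : ∑ x, p x = 1)
    {S : ℕ} (𝒜 : Finset (Finset X)) {C : ℝ}
    (hC : ∀ z : Fin S → X × X, ((diffTraces 𝒜 z).card : ℝ) ≤ C) (ε : ℝ) :
    ∑ z : Fin S → X × X, (∏ i, p (z i).1 * p (z i).2) *
        ∑ d ∈ diffTraces 𝒜 z, Real.exp (∑ i, ε * d i) ≤ C * Real.exp (S * ε ^ 2 / 2) := by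
  have hsym : ∀ σ : Fin S → Bool,
      ∑ z : Fin S → X × X, (∏ i, p (z i).1 * p (z i).2) *
        ∑ d ∈ diffTraces 𝒜 z, Real.exp (∑ i, ε * d i) =
      ∑ z : Fin S → X × X, (∏ i, p (z i).1 * p (z i).2) *
        ∑ d ∈ diffTraces 𝒜 z, Real.exp (∑ i, ε * (boolSign (σ i) * d i)) := by
    intro σ
    let sw : (Fin S → X × X) → (Fin S → X × X) := fun z i => if σ i then (z i).swap else z i
    have hsw : Function.Involutive sw := by
      intro z
      funext i
      cases hσ : σ i <;> simp [sw, hσ]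
    rw [← Equiv.sum_comp (hsw.toPerm sw)]
    refine Finset.sum_congr rfl fun z _ => ?_
    congr 1
    · refine Finset.prod_congr rfl fun i _ => ?_
      cases hσ : σ i <;> simp [sw, hσ, mul_comm]
    · exact diffTraces_swap 𝒜 z σ fun d => Real.exp (∑ i, ε * d i)
  have htot : ∑ z : Fin S → X × X, ∏ i, p (z i).1 * p (z i).2 = 1 := by
    have := (Finset.prod_univ_sum (fun _ : Fin S => (Finset.univ : Finset (X × X)))
      fun _ q => p q.1 * p q.2)
    rw [Fintype.piFinset_univ] at this
    rw [← this, Fintype.sum_prod_type]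
    simp [← Finset.mul_sum, hp1]
  have h2 : (2 : ℝ) ^ S * ∑ z : Fin S → X × X, (∏ i, p (z i).1 * p (z i).2) *
        ∑ d ∈ diffTraces 𝒜 z, Real.exp (∑ i, ε * d i) ≤
      2 ^ S * (C * Real.exp (S * ε ^ 2 / 2)) := by
    calc _ = ∑ σ : Fin S → Bool, ∑ z : Fin S → X × X, (∏ i, p (z i).1 * p (z i).2) *
        ∑ d ∈ diffTraces 𝒜 z, Real.exp (∑ i, ε * (boolSign (σ i) * d i)) := by
          rw [← Finset.sum_congr rfl fun σ _ => hsym σ]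
          simp
      _ = ∑ z : Fin S → X × X, (∏ i, p (z i).1 * p (z i).2) *
        ∑ d ∈ diffTraces 𝒜 z,
          ∑ σ : Fin S → Bool, Real.exp (∑ i, ε * (boolSign (σ i) * d i)) := by
          rw [Finset.sum_comm]
          refine Finset.sum_congr rfl fun z _ => ?_
          rw [← Finset.mul_sum, Finset.sum_comm]
      _ ≤ ∑ z : Fin S → X × X, (∏ i, p (z i).1 * p (z i).2) *
          (C * (2 ^ S * Real.exp (S * ε ^ 2 / 2))) := by
          refine Finset.sum_le_sum fun z _ => mul_le_mul_of_nonneg_left ?_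
            (Finset.prod_nonneg fun i _ => mul_nonneg (hp _) (hp _))
          calc _ ≤ ∑ d ∈ diffTraces 𝒜 z, 2 ^ S * Real.exp (S * ε ^ 2 / 2) := by
                refine Finset.sum_le_sum fun d hd => sum_sign_exp_le ε fun i => ?_
                simp only [diffTraces, Finset.mem_image] at hd
                obtain ⟨E, -, rfl⟩ := hd
                rw [abs_le]
                constructor <;> linarith [memIndicator_nonneg E (z i).1,
                  memIndicator_nonneg E (z i).2, memIndicator_le_one E (z i).1,
                  memIndicator_le_one E (z i).2]
            _ ≤ _ := by
                rw [Finset.sum_const, nsmul_eq_mul]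
                exact mul_le_mul_of_nonneg_right (hC z) (by positivity)
      _ = _ := by rw [← Finset.sum_mul, htot]; ring
  exact le_of_mul_le_mul_left h2 (by positivity)

open Classical in
/-- One-sided uniform deviation bound for a family of sets with few traces on paired samples. -/
theorem sum_prod_deviation_le (p : X → ℝ) (hp : ∀ x, 0 ≤ p x) (hp1 : ∑ x, p x = 1)
    {S : ℕ} (𝒜 : Finset (Finset X)) {C : ℝ}
    (hC : ∀ z : Fin S → X × X, ((diffTraces 𝒜 z).card : ℝ) ≤ C) {ε : ℝ} (hε : 0 ≤ ε) :
    ∑ y : Fin S → X with ∃ E ∈ 𝒜,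
        S * ε ≤ S * ∑ x, p x * memIndicator E x - ∑ i, memIndicator E (y i), ∏ i, p (y i) ≤
      C * Real.exp (-(S * ε ^ 2 / 2)) := by
  set bad : Finset (Fin S → X) := {y : Fin S → X | ∃ E ∈ 𝒜,
        S * ε ≤ S * ∑ x, p x * memIndicator E x - ∑ i, memIndicator E (y i)} with hbad
  -- Jensen's inequality replaces the true mean by an average over a ghost sample `y'`, coordinate
  -- by coordinate.
  have hjensen : ∀ E : Finset X, ∀ y : Fin S → X,
      Real.exp (ε * (S * ∑ x, p x * memIndicator E x - ∑ i, memIndicator E (y i))) ≤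
        ∑ y' : Fin S → X, (∏ i, p (y' i)) *
          Real.exp (∑ i, ε * (memIndicator E (y' i) - memIndicator E (y i))) := by
    intro E y
    calc Real.exp (ε * (S * ∑ x, p x * memIndicator E x - ∑ i, memIndicator E (y i)))
        = ∏ i, Real.exp (∑ x, p x * (ε * (memIndicator E x - memIndicator E (y i)))) := by
          rw [← Real.exp_sum]
          congr 1
          have : ∀ i, ∑ x, p x * (ε * (memIndicator E x - memIndicator E (y i))) =
              ε * (∑ x, p x * memIndicator E x) - ε * memIndicator E (y i) := by
            intro i
            calc _ = ε * (∑ x, p x * memIndicator E x) - (∑ x, p x) * (ε * memIndicator E (y i)) := by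
                  rw [Finset.mul_sum, Finset.sum_mul, ← Finset.sum_sub_distrib]
                  exact Finset.sum_congr rfl fun x _ => by ring
              _ = _ := by rw [hp1, one_mul]
          simp only [this, Finset.sum_sub_distrib, ← Finset.mul_sum, Finset.sum_const,
            Finset.card_univ, Fintype.card_fin, nsmul_eq_mul]
          ring
      _ ≤ ∏ i, ∑ x, p x * Real.exp (ε * (memIndicator E x - memIndicator E (y i))) := by
          refine Finset.prod_le_prod (fun i _ => (Real.exp_pos _).le) fun i _ => ?_
          simpa only [smul_eq_mul] using convexOn_exp.map_sum_le (t := Finset.univ) (w := p)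
            (p := fun x => ε * (memIndicator E x - memIndicator E (y i)))
            (fun x _ => hp x) hp1 (fun _ _ => Set.mem_univ _)
      _ = _ := by
          rw [Finset.prod_univ_sum, Fintype.piFinset_univ]
          refine Finset.sum_congr rfl fun y' _ => ?_
          rw [Finset.prod_mul_distrib, Real.exp_sum]
  have hpt : ∀ y ∈ bad, Real.exp (S * ε ^ 2) ≤ ∑ y' : Fin S → X, (∏ i, p (y' i)) *
      ∑ d ∈ diffTraces 𝒜 (fun i => (y i, y' i)), Real.exp (∑ i, ε * d i) := by
    intro y hy
    obtain ⟨E, hE, hy⟩ := (Finset.mem_filter.1 hy).2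
    calc Real.exp (S * ε ^ 2)
        ≤ Real.exp (ε * (S * ∑ x, p x * memIndicator E x - ∑ i, memIndicator E (y i))) := by
          rw [Real.exp_le_exp]
          have := mul_le_mul_of_nonneg_left hy hε
          linarith
      _ ≤ _ := hjensen E y
      _ ≤ _ := by
          refine Finset.sum_le_sum fun y' _ => mul_le_mul_of_nonneg_left ?_
            (Finset.prod_nonneg fun i _ => hp _)
          refine Finset.single_le_sum (f := fun d : Fin S → ℝ => Real.exp (∑ i, ε * d i))
            (fun d _ => (Real.exp_pos _).le) (Finset.mem_image_of_mem _ hE)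
  have hmain : (∑ y ∈ bad, ∏ i, p (y i)) * Real.exp (S * ε ^ 2) ≤
      C * Real.exp (S * ε ^ 2 / 2) := by
    calc (∑ y ∈ bad, ∏ i, p (y i)) * Real.exp (S * ε ^ 2)
        ≤ ∑ y ∈ bad, (∏ i, p (y i)) * ∑ y' : Fin S → X, (∏ i, p (y' i)) *
            ∑ d ∈ diffTraces 𝒜 (fun i => (y i, y' i)), Real.exp (∑ i, ε * d i) := by
          rw [Finset.sum_mul]
          exact Finset.sum_le_sum fun y hy => mul_le_mul_of_nonneg_left (hpt y hy)
            (Finset.prod_nonneg fun i _ => hp _)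
      _ ≤ ∑ y : Fin S → X, (∏ i, p (y i)) * ∑ y' : Fin S → X, (∏ i, p (y' i)) *
            ∑ d ∈ diffTraces 𝒜 (fun i => (y i, y' i)), Real.exp (∑ i, ε * d i) := by
          refine Finset.sum_le_sum_of_subset_of_nonneg (Finset.subset_univ _) fun y _ _ => ?_
          exact mul_nonneg (Finset.prod_nonneg fun i _ => hp _) (Finset.sum_nonneg fun y' _ =>
            mul_nonneg (Finset.prod_nonneg fun i _ => hp _)
              (Finset.sum_nonneg fun d _ => (Real.exp_pos _).le))
      _ = ∑ z : Fin S → X × X, (∏ i, p (z i).1 * p (z i).2) *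
            ∑ d ∈ diffTraces 𝒜 z, Real.exp (∑ i, ε * d i) := by
          rw [← (Equiv.arrowProdEquivProdArrow (Fin S) (fun _ => X) (fun _ => X)).symm.sum_comp,
            Fintype.sum_prod_type]
          refine Finset.sum_congr rfl fun y _ => ?_
          rw [Finset.mul_sum]
          refine Finset.sum_congr rfl fun y' _ => ?_
          simp only [Equiv.arrowProdEquivProdArrow, Equiv.coe_fn_symm_mk]
          rw [Finset.prod_mul_distrib, mul_assoc]
      _ ≤ _ := sum_paired_exp_le p hp hp1 𝒜 hC ε
  have hexp : C * Real.exp (-(S * ε ^ 2 / 2)) * Real.exp (S * ε ^ 2) =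
      C * Real.exp (S * ε ^ 2 / 2) := by
    rw [mul_assoc, ← Real.exp_add]
    congr 2; ring
  rw [← hexp] at hmain
  exact le_of_mul_le_mul_right hmain (Real.exp_pos _)

/-- Number of traces of an affine family of sets on a paired sample. -/
theorem card_diffTraces_le {κ : Type*} [Fintype κ] (F : X → κ → ℝ) (G : X → ℝ)
    (𝒜 : Finset (Finset X))
    (h𝒜 : ∀ E ∈ 𝒜, ∃ θ : κ → ℝ, ∀ x, x ∈ E ↔ G x < ∑ k, θ k * F x k)
    {S : ℕ} (z : Fin S → X × X) {t : ℝ} (ht : 0 < t) (ht1 : t ≤ 1) :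
    ((diffTraces 𝒜 z).card : ℝ) ≤ Real.exp (S * (2 * t)) * (t ^ Fintype.card κ)⁻¹ := by
  classical
  -- The paired sample is read as `2 S` labelled points. The trace of a set on them determines its
  -- difference vector, so Sauer-Shelah on the traces bounds the count.
  let pt : Fin S × Bool → X := fun q => if q.2 then (z q.1).2 else (z q.1).1
  let 𝒯 : Finset (Finset (Fin S × Bool)) := 𝒜.image fun E => Finset.univ.filter fun q => pt q ∈ E
  have h1 : diffTraces 𝒜 z = 𝒯.image fun s i => memIndicator s (i, true) - memIndicator s (i, false) := by
    rw [Finset.image_image]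
    refine Finset.image_congr fun E _ => ?_
    funext i
    simp [memIndicator, pt]
  have h2 : 𝒯.vcDim ≤ Fintype.card κ := by
    refine vcDim_le_of_affine (fun q => F (pt q)) (fun q => G (pt q)) 𝒯 fun s hs => ?_
    obtain ⟨E, hE, rfl⟩ := Finset.mem_image.1 hs
    obtain ⟨θ, hθ⟩ := h𝒜 E hE
    exact ⟨θ, fun q => by simp [hθ]⟩
  have h3 : (diffTraces 𝒜 z).card ≤ ∑ k ∈ Finset.Iic (Fintype.card κ), (S * 2).choose k := by
    calc (diffTraces 𝒜 z).card ≤ 𝒯.card := h1 ▸ Finset.card_image_le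
      _ ≤ 𝒯.shatterer.card := Finset.card_le_card_shatterer 𝒯
      _ ≤ ∑ k ∈ Finset.Iic 𝒯.vcDim, (Fintype.card (Fin S × Bool)).choose k :=
          Finset.card_shatterer_le_sum_vcDim
      _ = ∑ k ∈ Finset.Iic 𝒯.vcDim, (S * 2).choose k := by simp
      _ ≤ _ := Finset.sum_le_sum_of_subset (Finset.Iic_subset_Iic.2 h2)
  calc ((diffTraces 𝒜 z).card : ℝ)
      ≤ ((∑ k ∈ Finset.Iic (Fintype.card κ), (S * 2).choose k : ℕ) : ℝ) := by exact_mod_cast h3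
    _ ≤ _ := sum_choose_le_exp _ _ ht ht1
    _ = _ := by push_cast; rw [mul_assoc]

/-- Layer-cake estimate: if every superlevel set has weight at most `ε`, then a function with values
in `[0, B]` has weighted sum at most `B ε`. -/
theorem sum_mul_le_of_superlevel_le {ι : Type*} [Fintype ι] (c w : ι → ℝ) {B ε : ℝ} (hB : 0 ≤ B)
    (hw : ∀ i, 0 ≤ w i) (hwB : ∀ i, w i ≤ B)
    (h : ∀ t, 0 ≤ t → ∑ i, c i * (if t < w i then 1 else 0) ≤ ε) : ∑ i, c i * w i ≤ B * ε := by
  have hint : ∀ i, IntervalIntegrable (fun t => if t < w i then (1 : ℝ) else 0)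
      MeasureTheory.volume 0 B := by
    intro i
    refine AntitoneOn.intervalIntegrable fun s _ t _ hst => ?_
    split_ifs <;> linarith
  have hval : ∀ i, ∫ t in (0 : ℝ)..B, (if t < w i then (1 : ℝ) else 0) = w i := by
    intro i
    rw [← intervalIntegral.integral_add_adjacent_intervals (b := w i)
      ((hint i).mono_set (by
        rw [Set.uIcc_of_le (hw i), Set.uIcc_of_le hB]; exact Set.Icc_subset_Icc_right (hwB i)))
      ((hint i).mono_set (by
        rw [Set.uIcc_of_le (hwB i), Set.uIcc_of_le hB]; exact Set.Icc_subset_Icc_left (hw i)))]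
    -- The integrands differ at the endpoint `t = w i`, hence the passage to open intervals.
    have e1 : ∫ t in (0 : ℝ)..w i, (if t < w i then (1 : ℝ) else 0) = ∫ t in (0 : ℝ)..w i, (1 : ℝ) := by
      rw [intervalIntegral.integral_of_le (hw i), intervalIntegral.integral_of_le (hw i),
        MeasureTheory.integral_Ioc_eq_integral_Ioo, MeasureTheory.integral_Ioc_eq_integral_Ioo]
      exact MeasureTheory.setIntegral_congr_fun measurableSet_Ioo fun t ht => if_pos ht.2
    have e2 : ∫ t in (w i)..B, (if t < w i then (1 : ℝ) else 0) = ∫ t in (w i)..B, (0 : ℝ) := by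
      refine intervalIntegral.integral_congr fun t ht => ?_
      rw [Set.uIcc_of_le (hwB i)] at ht
      exact if_neg (not_lt.2 ht.1)
    rw [e1, e2]
    simp
  calc ∑ i, c i * w i = ∑ i, ∫ t in (0 : ℝ)..B, c i * (if t < w i then (1 : ℝ) else 0) := by
        refine Finset.sum_congr rfl fun i _ => ?_
        rw [intervalIntegral.integral_const_mul, hval]
    _ = ∫ t in (0 : ℝ)..B, ∑ i, c i * (if t < w i then (1 : ℝ) else 0) := by
        rw [intervalIntegral.integral_finsetSum fun i _ => (hint i).const_mul _]
    _ ≤ ∫ _t in (0 : ℝ)..B, ε := by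
        refine intervalIntegral.integral_mono_on hB ?_ (by simp) fun t ht => h t ht.1
        simpa only [Finset.sum_fn] using
          IntervalIntegrable.sum Finset.univ fun i _ => (hint i).const_mul (c i)
    _ = B * ε := by simp

end VapnikChervonenkis

/-! ### Transfer to independent random samples. -/

section Sampling

open MeasureTheory ProbabilityTheory

open Classical in
/-- Uniform one-sided deviation bound for the positivity sets of an affine family. -/
theorem sum_prod_affine_deviation_le {X κ : Type*} [Fintype X] [Fintype κ] (p : X → ℝ)
    (hp : ∀ x, 0 ≤ p x) (hp1 : ∑ x, p x = 1) (F : X → κ → ℝ) (G : X → ℝ) (S : ℕ)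
    {ε : ℝ} (hε : 0 < ε) (hε1 : ε ≤ 1) :
    ∑ y : Fin S → X with ∃ E : Finset X, (∃ θ : κ → ℝ, ∀ x, x ∈ E ↔ G x < ∑ k, θ k * F x k) ∧
        S * ε ≤ S * ∑ x, p x * memIndicator E x - ∑ i, memIndicator E (y i), ∏ i, p (y i) ≤
      ((ε ^ 2 / 8) ^ Fintype.card κ)⁻¹ * Real.exp (-(S * ε ^ 2 / 4)) := by
  -- With `t = ε ^ 2 / 8` the growth factor is `exp (S ε ^ 2 / 4)`, half of the available exponent
  -- `S ε ^ 2 / 2`.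
  have h := sum_prod_deviation_le p hp hp1
    (S := S) (Finset.univ.filter fun E : Finset X =>
      ∃ θ : κ → ℝ, ∀ x, x ∈ E ↔ G x < ∑ k, θ k * F x k)
    (fun z => card_diffTraces_le F G _ (fun E hE => (Finset.mem_filter.1 hE).2) z
      (t := ε ^ 2 / 8) (by positivity) (by nlinarith)) hε.le
  simp only [Finset.mem_filter, Finset.mem_univ, true_and] at h
  refine h.trans_eq ?_
  rw [mul_comm (Real.exp _), mul_assoc, ← Real.exp_add]
  congr 2
  ring

variable {X : Type*} [Fintype X] [MeasurableSpace X] [MeasurableSingletonClass X]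
  {Ω : Type*} [MeasurableSpace Ω] {Pr : Measure Ω} [IsProbabilityMeasure Pr] {S : ℕ}
  {samp : Fin S → Ω → X} {p : X → ℝ}

theorem measureReal_sample_mem_le (hind : iIndepFun samp Pr)
    (hlaw : ∀ i x, Pr.real {ω | samp i ω = x} = p x) (D : Finset (Fin S → X)) :
    Pr.real {ω | (fun i => samp i ω) ∈ D} ≤ ∑ y ∈ D, ∏ i, p (y i) := by
  have h1 : {ω | (fun i => samp i ω) ∈ D} ⊆ ⋃ y ∈ D, ⋂ i, samp i ⁻¹' {y i} := by
    intro ω hω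
    simp only [Set.mem_iUnion, Set.mem_iInter]
    exact ⟨_, hω, fun i => rfl⟩
  refine (measureReal_mono h1 (measure_ne_top _ _)).trans ((measureReal_biUnion_finset_le _ _).trans_eq ?_)
  refine Finset.sum_congr rfl fun y _ => ?_
  have h2 := hind.measure_inter_preimage_eq_mul Finset.univ (sets := fun i => {y i})
    fun i _ => measurableSet_singleton _
  simp only [Finset.mem_univ, Set.iInter_true] at h2
  rw [Measure.real, h2, ENNReal.toReal_prod]
  exact Finset.prod_congr rfl fun i _ => hlaw i (y i)

theorem sum_law_eq_one {Z : Ω → X} (hmeas : Measurable Z)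
    (hlaw : ∀ x, Pr.real {ω | Z ω = x} = p x) : ∑ x, p x = 1 := by
  have h := sum_measureReal_preimage_singleton (μ := Pr) (f := Z) Finset.univ
    fun x _ => hmeas (measurableSet_singleton x)
  simp only [Finset.coe_univ, Set.preimage_univ, probReal_univ] at h
  rw [← h]
  exact Finset.sum_congr rfl fun x _ => (hlaw x).symm

/-- Expectation of a function of a random element of a finite type. -/
theorem integral_comp_of_law {Z : Ω → X} (hmeas : Measurable Z)
    (hlaw : ∀ x, Pr.real {ω | Z ω = x} = p x) (v : X → ℝ) : ∫ ω, v (Z ω) ∂Pr = ∑ x, p x * v x := by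
  have : IsProbabilityMeasure (Pr.map Z) := Measure.isProbabilityMeasure_map hmeas.aemeasurable
  rw [← integral_map hmeas.aemeasurable (Measurable.of_discrete (f := v)).aestronglyMeasurable,
    integral_fintype Integrable.of_finite]
  refine Finset.sum_congr rfl fun x _ => ?_
  rw [map_measureReal_apply hmeas (measurableSet_singleton x), smul_eq_mul, ← hlaw x]
  rfl

/-- Hoeffding's inequality for the empirical mean of a `[0, B]`-valued function. -/
theorem measureReal_empirical_ge_le (hmeas : ∀ i, Measurable (samp i)) (hind : iIndepFun samp Pr)
    (hlaw : ∀ i x, Pr.real {ω | samp i ω = x} = p x) {v : X → ℝ} {B : ℝ} (hv : ∀ x, 0 ≤ v x)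
    (hvB : ∀ x, v x ≤ B) {ε : ℝ} (hε : 0 ≤ ε) :
    Pr.real {ω | S * ε ≤ ∑ i, v (samp i ω) - S * ∑ x, p x * v x} ≤
      Real.exp (-(S * ε) ^ 2 / (2 * (S * (B / 2) ^ 2))) := by
  have hsub : ∀ i ∈ (Finset.univ : Finset (Fin S)),
      HasSubgaussianMGF (fun ω => v (samp i ω) - ∑ x, p x * v x) ((‖B - 0‖₊ / 2) ^ 2) Pr := by
    intro i _
    have h := hasSubgaussianMGF_of_mem_Icc (μ := Pr) (X := fun ω => v (samp i ω)) (a := 0) (b := B)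
      ((Measurable.of_discrete (f := v)).comp (hmeas i)).aemeasurable
      (Filter.Eventually.of_forall fun ω => ⟨hv _, hvB _⟩)
    rwa [integral_comp_of_law (hmeas i) (hlaw i) v] at h
  have h := HasSubgaussianMGF.measure_sum_ge_le_of_iIndepFun
    (hind.comp (fun _ x => v x - ∑ x, p x * v x) fun _ => Measurable.of_discrete) hsub
    (ε := S * ε) (by positivity)
  simp only [Function.comp_apply, Finset.sum_sub_distrib, Finset.sum_const, Finset.card_univ,
    Fintype.card_fin, nsmul_eq_mul] at h
  refine h.trans_eq ?_
  congr 2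
  push_cast
  rw [sub_zero, Real.norm_eq_abs, div_pow, sq_abs, div_pow]

end Sampling

/-- Consequences of the sample size for the two exponential tail bounds. -/
theorem sample_size_bounds {ε δ s : ℝ} {K : ℕ} (hε : 0 < ε) (hε1 : ε ≤ 1) (hδ : 0 < δ)
    (hδ1 : δ ≤ 1)
    (hs : 64 / ε ^ 2 * (2 * (K + 2) * Real.log (16 * Real.exp 1 / ε) + Real.log (8 / δ)) ≤ s) :
    0 < s ∧ ((ε ^ 2 / 8) ^ (K + 1))⁻¹ * Real.exp (-(s * ε ^ 2 / 4)) ≤ δ / 2 ∧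
      Real.exp (-(2 * s * ε ^ 2)) ≤ δ / 2 := by
  set L := Real.log (16 * Real.exp 1 / ε) with hL
  set D := Real.log (8 / δ) with hD
  have he : 1 ≤ Real.exp 1 := Real.one_le_exp zero_le_one
  have hq : 1 ≤ 16 * Real.exp 1 / ε := by rw [le_div_iff₀ hε]; linarith
  have hL0 : 0 ≤ L := Real.log_nonneg hq
  have hD0 : 0 < D := Real.log_pos (by rw [lt_div_iff₀ hδ]; linarith)
  have hexpD : Real.exp (-D) ≤ δ / 2 := by
    rw [Real.exp_neg, hD, Real.exp_log (by positivity), inv_div]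
    linarith
  have hKL : 0 ≤ (K : ℝ) * L := by positivity
  have hs' : 64 * (2 * (K + 2) * L + D) ≤ s * ε ^ 2 := by
    rw [div_mul_eq_mul_div, div_le_iff₀ (by positivity)] at hs
    exact hs
  have hs0 : 0 < s * ε ^ 2 := by nlinarith
  refine ⟨pos_of_mul_pos_left hs0 (by positivity), ?_, ?_⟩
  -- Each parameter contributes at most `2 L` to the exponent. A quarter of `s ε ^ 2` is at least
  -- `16 (2 (K + 2) L + D)`, which pays for `2 (K + 1) L + D`.
  · have h1 : (ε ^ 2 / 8)⁻¹ ≤ Real.exp (2 * L) := by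
      have : Real.exp (2 * L) = (16 * Real.exp 1 / ε) ^ 2 := by
        rw [two_mul, Real.exp_add, hL, Real.exp_log (by positivity), sq]
      rw [this, inv_div, div_pow]
      gcongr
      nlinarith
    calc ((ε ^ 2 / 8) ^ (K + 1))⁻¹ * Real.exp (-(s * ε ^ 2 / 4))
        ≤ Real.exp (2 * L) ^ (K + 1) * Real.exp (-(s * ε ^ 2 / 4)) := by
          rw [← inv_pow]
          gcongr
      _ = Real.exp (2 * (K + 1) * L - s * ε ^ 2 / 4) := by
          rw [← Real.exp_nat_mul, ← Real.exp_add]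
          congr 1
          push_cast
          ring
      _ ≤ Real.exp (-D) := Real.exp_le_exp.2 (by nlinarith)
      _ ≤ δ / 2 := hexpD
  · exact (Real.exp_le_exp.2 (by nlinarith)).trans hexpD

/-! ### Uniform deviation of the policy violation, and the final assembly. -/

namespace DiscountedMDP

variable {X A : Type*} [Fintype X] [DecidableEq X] [Nonempty X] [Fintype A] [Nonempty A]
  {K : ℕ} {Φ : Matrix X (Fin K) ℝ} {N : Set (Fin K → ℝ)}

open MeasureTheory ProbabilityTheory in
/-- Uniformly over weights, the mean violation of one policy's Bellman inequality exceeds its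
empirical mean by at most `B ε`, up to an event of small probability. -/
theorem measureReal_policyViolation_deviation_le [MeasurableSpace X] [MeasurableSingletonClass X]
    (M : DiscountedMDP X A) (μ : X → A) (Φ : Matrix X (Fin K) ℝ) {B : ℝ} (hB : 0 ≤ B)
    {Ω : Type*} [MeasurableSpace Ω] {Pr : Measure Ω} [IsProbabilityMeasure Pr] {S : ℕ} (hS : 0 < S)
    {samp : Fin S → Ω → X} {p : X → ℝ} (hmeas : ∀ i, Measurable (samp i))
    (hind : iIndepFun samp Pr) (hlaw : ∀ i x, Pr.real {ω | samp i ω = x} = p x)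
    {ε : ℝ} (hε : 0 < ε) (hε1 : ε ≤ 1) :
    Pr.real {ω | ∃ r : Fin K → ℝ, (∀ x, M.policyViolation Φ μ r x ≤ B) ∧
      S * (B * ε) < S * ∑ x, p x * M.policyViolation Φ μ r x -
        ∑ i, M.policyViolation Φ μ r (samp i ω)} ≤
      ((ε ^ 2 / 8) ^ (K + 1))⁻¹ * Real.exp (-(S * ε ^ 2 / 4)) := by
  classical
  -- The extra coordinate `none`, with feature `-1`, carries the threshold `t`, giving `K + 1`
  -- parameters in all.
  let F : X → Option (Fin K) → ℝ := fun x o =>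
    o.elim (-1) fun k => Φ x k - M.α * ∑ x', M.P (μ x) x x' * Φ x' k
  let G : X → ℝ := fun x => M.g x (μ x)
  have hF : ∀ (r : Fin K → ℝ) (t : ℝ) (x : X),
      ∑ o, (fun o : Option (Fin K) => o.elim t r) o * F x o =
        (Φ *ᵥ r) x - M.α * ∑ x', M.P (μ x) x x' * (Φ *ᵥ r) x' - t := by
    intro r t x
    rw [Fintype.sum_option]
    simp only [F, Option.elim, mulVec, dotProduct, mul_sub, Finset.sum_sub_distrib]
    have : ∑ k, r k * (M.α * ∑ x', M.P (μ x) x x' * Φ x' k) =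
        M.α * ∑ x', M.P (μ x) x x' * ∑ k, Φ x' k * r k := by
      simp only [Finset.mul_sum]
      rw [Finset.sum_comm]
      exact Finset.sum_congr rfl fun _ _ => Finset.sum_congr rfl fun _ _ => by ring
    rw [this, Finset.sum_congr rfl fun k _ => mul_comm (r k) (Φ x k)]
    ring
  let i₀ : Fin S := ⟨0, hS⟩
  have hp : ∀ x, 0 ≤ p x := fun x => hlaw i₀ x ▸ measureReal_nonneg
  have hp1 : ∑ x, p x = 1 := sum_law_eq_one (hmeas i₀) (hlaw i₀)
  have hbound := sum_prod_affine_deviation_le p hp hp1 F G S hε hε1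
  rw [Fintype.card_option, Fintype.card_fin] at hbound
  refine (measureReal_mono ?_).trans ((measureReal_sample_mem_le hind hlaw _).trans hbound)
  rintro ω ⟨r, hrB, hr⟩
  simp only [Finset.mem_filter, Finset.mem_univ, true_and, Set.mem_ofPred_eq]
  by_contra! hcon
  refine not_le.2 hr ?_
  -- True and empirical means are merged into one signed sum over states and samples. For `t ≥ 0`
  -- the positive part does not change the superlevel set, which is therefore in the affine family.
  have hlayer := sum_mul_le_of_superlevel_le (ι := X ⊕ Fin S)
    (Sum.elim (fun x => S * p x) fun _ => -1)
    (Sum.elim (fun x => M.policyViolation Φ μ r x) fun i => M.policyViolation Φ μ r (samp i ω))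
    (B := B) (ε := S * ε) hB
    (by rintro (x | i) <;> exact M.policyViolation_nonneg Φ μ r _)
    (by rintro (x | i) <;> exact hrB _) (by
      intro t ht
      let E : Finset X := Finset.univ.filter fun x => t < M.policyViolation Φ μ r x
      have hE : ∀ x, memIndicator E x = if t < M.policyViolation Φ μ r x then 1 else 0 := by
        intro x
        simp [memIndicator, E]
      have := (hcon E ⟨fun o => o.elim t r, fun x => by
        rw [hF]
        simp only [E, G, Finset.mem_filter, Finset.mem_univ, true_and, policyViolation, lt_max_iff]
        constructor
        · rintro (h | h) <;> linarith
        · intro h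
          left
          linarith⟩).le
      rw [Fintype.sum_sum_type]
      simp only [Sum.elim_inl, Sum.elim_inr, neg_mul, one_mul, Finset.sum_neg_distrib, mul_assoc,
        ← Finset.mul_sum]
      simp only [hE] at this
      refine le_trans (le_of_eq ?_) this
      rw [sub_eq_add_neg]
      congr!)
  rw [Fintype.sum_sum_type] at hlayer
  simp only [Sum.elim_inl, Sum.elim_inr, neg_mul, one_mul, Finset.sum_neg_distrib, mul_assoc,
    ← Finset.mul_sum] at hlayer
  linarith

/-- Deterministic performance bound for the sampled program, on the event that empirical means are
accurate in the two one-sided senses used. -/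
theorem IsSampledSALPOptimal.weightedOneNorm_le {M : DiscountedMDP X A} {μ : X → A}
    (hμ : M.IsOptimalPolicy μ) {ν : X → ℝ} (hν : ∀ x, 0 ≤ ν x) {rSALP : Fin K → ℝ}
    (hopt : M.IsSALPOptimal Φ ν μ rSALP) (hmem : rSALP ∈ N) {S : ℕ} (hS : 0 < S)
    {y : Fin S → X} {ε : ℝ}
    (hlower : ∀ r ∈ N, S * (M.visitDist μ ν ⬝ᵥ M.policyViolation Φ μ r) -
      ∑ i, M.policyViolation Φ μ r (y i) ≤ S * ε)
    (hupper : ∑ i, M.violation Φ rSALP (y i) -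
      S * (M.visitDist μ ν ⬝ᵥ M.violation Φ rSALP) ≤ S * ε)
    {rhat : Fin K → ℝ} (hrhat : M.IsSampledSALPOptimal Φ ν N y rhat) :
    weightedOneNorm ν (M.optCostToGo - Φ *ᵥ rhat) ≤
      sInf (Set.image2 (M.approxBound Φ ν μ) N (weightingFunctions X)) + 4 * ε / (1 - M.α) := by
  have hα := sub_pos.2 M.α_lt_one
  have hS' : (0 : ℝ) < S := Nat.cast_pos.2 hS
  obtain ⟨s, ⟨hs, hs0, hN⟩, hbest⟩ := hrhat
  obtain ⟨s', ⟨hs', hs'0⟩, hbest'⟩ := hopt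
  have hviol : ∑ i, M.policyViolation Φ μ rhat (y i) ≤ ∑ i, s i := Finset.sum_le_sum fun i _ =>
    (M.policyViolation_le_violation Φ μ rhat (y i)).trans (M.violation_le Φ (hs i) (hs0 i))
  have hviol' : M.visitDist μ ν ⬝ᵥ M.violation Φ rSALP ≤ M.visitDist μ ν ⬝ᵥ s' :=
    Finset.sum_le_sum fun x _ => mul_le_mul_of_nonneg_left
      (M.violation_le Φ (hs' x) (hs'0 x)) (M.visitDist_nonneg μ hν x)
  have h1 := hμ.weightedOneNorm_le Φ hν rhat
  have h2 := hbest rSALP (fun i => M.violation Φ rSALP (y i))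
    ⟨fun i => (M.SALPFeasible_violation Φ rSALP).1 (y i),
      fun i => M.violation_nonneg Φ rSALP (y i), hmem⟩
  have hlow := hlower rhat hN
  rw [← sub_le_iff_le_add]
  refine le_csInf ⟨_, Set.mem_image2_of_mem hmem (show (fun _ => 1) ∈ weightingFunctions X from
    fun _ => le_rfl)⟩ ?_
  rintro _ ⟨r, -, ψ, hψ, rfl⟩
  refine le_trans ?_ (hμ.sub_SALPObjective_le_approxBound Φ hν r hψ)
  have h3 := hbest' r _ (M.SALPFeasible_violation Φ r)
  refine le_trans ?_ (sub_le_sub_left h3 _)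
  unfold SampledObjective at h2
  unfold SALPObjective
  have e : ∀ c : ℝ, 2 / ((1 - M.α) * S) * c = 2 * (c / S) / (1 - M.α) := fun c => by
    field_simp
  rw [e, e] at h2
  -- `b1` passes from the true mean to the sampled objective at `rhat`, and `b2` returns from the
  -- sampled objective to the true one at `rSALP`.
  have b1 : M.visitDist μ ν ⬝ᵥ M.policyViolation Φ μ rhat ≤ (∑ i, s i) / S + ε := by
    rw [← sub_le_iff_le_add, le_div_iff₀ hS']
    linarith
  have b2 : (∑ i, M.violation Φ rSALP (y i)) / S ≤ M.visitDist μ ν ⬝ᵥ s' + ε := by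
    rw [div_le_iff₀ hS']
    have := mul_le_mul_of_nonneg_left hviol' hS'.le
    linarith
  have c1 : 2 * (M.visitDist μ ν ⬝ᵥ M.policyViolation Φ μ rhat) / (1 - M.α) ≤
      2 * ((∑ i, s i) / S) / (1 - M.α) + 2 * ε / (1 - M.α) := by
    rw [← add_div]
    exact div_le_div_of_nonneg_right (by linarith) hα.le
  have c2 : 2 * ((∑ i, M.violation Φ rSALP (y i)) / S) / (1 - M.α) ≤
      2 * (M.visitDist μ ν ⬝ᵥ s') / (1 - M.α) + 2 * ε / (1 - M.α) := by
    rw [← add_div]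
    exact div_le_div_of_nonneg_right (by linarith) hα.le
  have c3 : 4 * ε / (1 - M.α) = 2 * ε / (1 - M.α) + 2 * ε / (1 - M.α) := by ring
  linarith

end DiscountedMDP

theorem theorem4
    {X A : Type*} [Fintype X] [DecidableEq X] [Nonempty X]
    [MeasurableSpace X] [MeasurableSingletonClass X]
    [Fintype A] [Nonempty A]
    (M : DiscountedMDP X A)
    -- an optimal policy
    (μstar : X → A) (hμ : M.IsOptimalPolicy μstar)
    -- state-relevance weights forming a probability distribution
    (ν : X → ℝ) (hν_nonneg : ∀ x, 0 ≤ ν x) (hν_sum : ∑ x, ν x = 1)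
    -- the columns of `Φ` are the basis functions; their span contains the constants
    {K : ℕ} (Φ : Matrix X (Fin K) ℝ)
    (hΦ : (fun _ => 1 : X → ℝ) ∈ Submodule.span ℝ (Set.range fun k : Fin K => fun x => Φ x k))
    -- the bounding set contains an optimal solution of the SALP
    (N : Set (Fin K → ℝ)) (rSALP : Fin K → ℝ)
    (hopt : M.IsSALPOptimal Φ ν μstar rSALP) (hmem : rSALP ∈ N)
    -- `B = sup_{r ∈ N} ‖(Φ r - T Φ r)⁺‖_∞`, which is finite
    (B : ℝ) (hB : IsLUB ((fun r => ‖M.violation Φ r‖) '' N) B)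
    (ε : ℝ) (hε : 0 < ε) (hεB : ε ≤ B)
    (δ : ℝ) (hδ : 0 < δ) (hδ' : δ ≤ 1 / 2)
    (S : ℕ)
    (hS : 64 * B ^ 2 / ε ^ 2 *
        (2 * (K + 2) * Real.log (16 * Real.exp 1 * B / ε) + Real.log (8 / δ)) ≤ (S : ℝ))
    -- `S` i.i.d. states with law `π_{μ*,ν}`
    {Ω : Type*} [MeasurableSpace Ω] (ℙ : MeasureTheory.Measure Ω)
    [MeasureTheory.IsProbabilityMeasure ℙ]
    (samp : Fin S → Ω → X) (hsamp_meas : ∀ i, Measurable (samp i))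
    (hsamp_indep : ProbabilityTheory.iIndepFun samp ℙ)
    (hsamp_law : ∀ i x, ℙ.real {ω | samp i ω = x} = M.visitDist μstar ν x) :
    1 - δ - (2 : ℝ) ^ (-383 : ℤ) * δ ^ 128 ≤
      ℙ.real {ω | ∀ rhat : Fin K → ℝ,
        M.IsSampledSALPOptimal Φ ν N (fun i => samp i ω) rhat →
          weightedOneNorm ν (M.optCostToGo - Φ *ᵥ rhat) ≤
            sInf (Set.image2 (M.approxBound Φ ν μstar) N (weightingFunctions X))
              + 4 * ε / (1 - M.α)} := by
  set p := M.visitDist μstar ν with hp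
  have hB0 : 0 < B := hε.trans_le hεB
  have hε' : 0 < ε / B := div_pos hε hB0
  have hε1 : ε / B ≤ 1 := (div_le_one hB0).2 hεB
  have hviolB : ∀ r ∈ N, ∀ x, M.violation Φ r x ≤ B := fun r hr x =>
    (le_abs_self _).trans ((norm_le_pi_norm (M.violation Φ r) x).trans
      (hB.1 (Set.mem_image_of_mem _ hr)))
  -- The accuracy is normalised to `ε / B`, the deviation allowed for indicators.
  obtain ⟨hS0, hb1, hb2⟩ := sample_size_bounds (K := K) (s := S) hε' hε1 hδ (by linarith) (by
    convert hS using 2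
    · field_simp
    · field_simp)
  have hS0' : 0 < S := Nat.cast_pos.1 hS0
  have h1 := (M.measureReal_policyViolation_deviation_le μstar Φ hB0.le hS0' hsamp_meas hsamp_indep
    hsamp_law hε' hε1).trans hb1
  have h2 := (measureReal_empirical_ge_le hsamp_meas hsamp_indep hsamp_law
    (M.violation_nonneg Φ rSALP) (hviolB rSALP hmem) hε.le).trans (le_trans (le_of_eq (by
      congr 1
      field_simp)) hb2)
  rw [mul_div_cancel₀ _ hB0.ne'] at h1
  set bad₁ := {ω | ∃ r : Fin K → ℝ, (∀ x, M.policyViolation Φ μstar r x ≤ B) ∧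
      S * ε < S * ∑ x, p x * M.policyViolation Φ μstar r x -
        ∑ i, M.policyViolation Φ μstar r (samp i ω)} with hbad₁
  set bad₂ := {ω | S * ε ≤ ∑ i, M.violation Φ rSALP (samp i ω) -
      S * ∑ x, p x * M.violation Φ rSALP x} with hbad₂
  -- Covering the space and using subadditivity avoids any measurability question about the good
  -- event.
  have hcover : (1 : ℝ) ≤ ℙ.real ({ω | ∀ rhat : Fin K → ℝ,
      M.IsSampledSALPOptimal Φ ν N (fun i => samp i ω) rhat →
        weightedOneNorm ν (M.optCostToGo - Φ *ᵥ rhat) ≤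
          sInf (Set.image2 (M.approxBound Φ ν μstar) N (weightingFunctions X))
            + 4 * ε / (1 - M.α)} ∪ (bad₁ ∪ bad₂)) := by
    refine (MeasureTheory.probReal_univ (μ := ℙ)).symm.le.trans
      (MeasureTheory.measureReal_mono fun ω _ => ?_)
    by_cases hω : ω ∈ bad₁ ∪ bad₂
    · exact Or.inr hω
    left
    intro rhat hrhat
    rw [Set.mem_union, not_or] at hω
    refine hrhat.weightedOneNorm_le hμ hν_nonneg hopt hmem hS0' (fun r hr => ?_) ?_
    · exact not_lt.1 fun h => hω.1 ⟨r, fun x =>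
        (M.policyViolation_le_violation Φ μstar r x).trans (hviolB r hr x), h⟩
    · exact (not_le.1 hω.2).le
  have h3 := MeasureTheory.measureReal_union_le (μ := ℙ) bad₁ bad₂
  have h4 := hcover.trans (MeasureTheory.measureReal_union_le _ _)
  -- The two tails already sum to at most `δ`, so this term is pure slack.
  have h5 : (0 : ℝ) ≤ (2 : ℝ) ^ (-383 : ℤ) * δ ^ 128 := by positivity
  linarith
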